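/- An ordinal graph is a small category $\Lambda$ (regarded as its set of morphisms, called paths, with source and range maps $s,r$ into the identities, called vertices; $ef$ is defined when $s(e)=r(f)$) together with a functor $d:\Lambda\to\mathrm{Ord}$, so $d(ef)=d(e)+d(f)$, such that for every $e\in\Lambda$ and every ordinal $\alpha\le d(e)$ there are unique $f,g\in\Lambda$ with $e=fg$ and $d(f)=\alpha$. Put $\Lambda^{\alpha}=\{f: d(f)=\alpha\}$ and $\Lambda_\alpha=\{f: d(f)<\omega^\alpha\}$; $\Lambda_\alpha$ is again an ordinal graph, with the same vertices. For a vertex $v$ write $vX=\{f\in X: r(f)=v\}$. The vertex $v$ is $\alpha$-regular if $v\Lambda^{\omega^\alpha}$ is finite and $s(e)\Lambda^{\omega^\alpha}\neq\emptyset$ for every $e\in v\Lambda_\alpha$. $\mathcal O(\Lambda)$ is the universal C*-algebra generated by partial isometries $T_e$, where $e$ is a vertex or $d(e)$ is a power of $\omega$, subject to: (1) $T_e^*T_e=T_{s(e)}$; (2) $T_eT_f=T_{ef}$ if $s(e)=r(f)$ and $d(e)<d(f)$; (3) $T_e^*T_f=0$ if $e\Lambda\cap f\Lambda=\emptyset$;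 (4) $T_v=\sum_{e\in v\Lambda^{\omega^\beta}}T_eT_e^*$ if the vertex $v$ is $\beta$-regular. For an arbitrary path $e$, $T_e$ denotes the product $T_{e_1}\cdots T_{e_n}$, where $e=e_1\cdots e_n$ is the factorization of $e$ according to the Cantor normal form $d(e)=\omega^{\beta_1}+\dots+\omega^{\beta_n}$, $\beta_1\ge\dots\ge\beta_n$. For each ordinal $\gamma$ let $\rho_\gamma:\mathcal O(\Lambda_\gamma)\to\mathcal O(\Lambda)$ be the $*$-homomorphism that maps each generator $S_e$ of $\mathcal O(\Lambda_\gamma)$ to the generator $T_e$ of $\mathcal O(\Lambda)$. Proposition. Let $\Lambda$ be an ordinal graph and $\alpha$ an ordinal. The homomorphism $\rho_{\alpha+1}:\mathcal O(\Lambda_{\alpha+1})\to\mathcal O(\Lambda)$ is injective only if there is no path $f\in\Lambda^{\omega^{\alpha+1}}$ such that $r(f)$ is $(\alpha+1)$-regular (in $\Lambda$) and $f=gf$ for some $g\in\Lambda_{\alpha+1}\setminus\Lambda_\alpha$. Moreover, if $f$ and $g$ are such paths and $v=r(f)$, then there is an integer $n\ge 1$ such that $S_g^n-S_v$ is a nonzero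 element of the kernel of $\rho_{\alpha+1}$. -/

import Mathlib

open CategoryTheory
open scoped Ordinal ENNReal

universe u

namespace OrdGraph

/-- An ordinal graph: a small category with a length functor `d` into the ordinals that has unique
factorization. A path `e` with source `x` and range `y` is a morphism `e : x ⟶ y`, so the
composite written `ef` in the order "range to source" is `f ≫ e`, and `d (ef) = d e + d f`. -/
class OrdinalGraph (Λ : Type u) [SmallCategory Λ] where
  /-- the length of a path -/
  d : ∀ {x y : Λ}, (x ⟶ y) → Ordinal.{u}
  d_id : ∀ x : Λ, d (𝟙 x) = 0
  d_comp : ∀ {x y z : Λ} (f : x ⟶ y) (e : y ⟶ z), d (f ≫ e) = d e + d f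
  factor : ∀ {x y : Λ} (e : x ⟶ y) (α : Ordinal.{u}), α ≤ d e →
    ∃! p : Σ z : Λ, (z ⟶ y) × (x ⟶ z), d p.2.1 = α ∧ p.2.2 ≫ p.2.1 = e

open OrdinalGraph

section Basic

variable {Λ : Type u} [SmallCategory Λ] [OrdinalGraph Λ]

/-- The set `vΛ^α` of paths of length `α` with range `v`. -/
def PathsTo (v : Λ) (α : Ordinal.{u}) : Type u := Σ x : Λ, {f : x ⟶ v // d f = α}

/-- `v` is `α`-source-regular: every path `e` in `vΛ_α` can be followed by a path of length `ω ^ α`. -/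
def IsSourceRegular (v : Λ) (α : Ordinal.{u}) : Prop :=
  ∀ (x : Λ) (e : x ⟶ v), d e < ω ^ α → Nonempty (PathsTo x (ω ^ α))

/-- `v` is `α`-row-finite. -/
def IsRowFinite (v : Λ) (α : Ordinal.{u}) : Prop := Finite (PathsTo v (ω ^ α))

/-- `v` is `α`-regular. -/
def IsRegular (v : Λ) (α : Ordinal.{u}) : Prop := IsSourceRegular v α ∧ IsRowFinite v α

/-- The set `eΛ` of all paths of the form `eg`. -/
def extensions (e : Arrow Λ) : Set (Arrow Λ) :=
  {b | ∃ (z : Λ) (g : z ⟶ e.left), b = Arrow.mk (g ≫ e.hom)}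

/-- The paths that index the generators: vertices, and paths whose length is a power of `ω`. -/
def IsGen (e : Arrow Λ) : Prop := d e.hom = 0 ∨ ∃ β : Ordinal.{u}, d e.hom = ω ^ β

theorem d_comp_of_lt {x y z : Λ} (f : x ⟶ y) (e : y ⟶ z)
    (hf : IsGen (Arrow.mk f)) (h : d e < d f) : d (f ≫ e) = d f := by
  rw [d_comp]
  rcases hf with hf | ⟨β, hf⟩
  · simp only [Arrow.mk_hom] at hf
    rw [hf] at h
    exact absurd h not_lt_zero
  · simp only [Arrow.mk_hom] at hf
    rw [hf] at h ⊢
    exact Ordinal.add_omega0_opow h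

theorem IsGen.comp {x y z : Λ} (f : x ⟶ y) (e : y ⟶ z)
    (hf : IsGen (Arrow.mk f)) (h : d e < d f) : IsGen (Arrow.mk (f ≫ e)) := by
  have := d_comp_of_lt f e hf h
  unfold IsGen at hf ⊢
  simp only [Arrow.mk_hom] at hf ⊢
  rwa [this]

variable (Λ) in
/-- The index set of the generators. -/
def Gen : Type u := {e : Arrow Λ // IsGen e}

/-- The vertex `v` as an index of a generator. -/
def Gen.vertex (v : Λ) : Gen Λ := ⟨Arrow.mk (𝟙 v), Or.inl (d_id v)⟩

/-- A path of length `ω ^ β` with range `v` as an index of a generator. -/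
def Gen.ofPath {v : Λ} {β : Ordinal.{u}} (p : PathsTo v (ω ^ β)) : Gen Λ :=
  ⟨Arrow.mk p.2.1, Or.inr ⟨β, p.2.2⟩⟩

/-- The initial segment `e(α)` of `e` of length `α`, together with the rest `e(α)⁻¹e`. -/
noncomputable def split {x y : Λ} (e : x ⟶ y) (α : Ordinal.{u}) (h : α ≤ d e) :
    Σ z : Λ, (z ⟶ y) × (x ⟶ z) := (factor e α h).choose

theorem split_spec {x y : Λ} (e : x ⟶ y) (α : Ordinal.{u}) (h : α ≤ d e) :
    d (split e α h).2.1 = α ∧ (split e α h).2.2 ≫ (split e α h).2.1 = e :=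
  (factor e α h).choose_spec.1

theorem log_le {e : Arrow Λ} (h : ¬ IsGen e) : ω ^ Ordinal.log ω (d e.hom) ≤ d e.hom :=
  Ordinal.opow_log_le_self ω fun h0 => h (Or.inl h0)

/-- For a path `e` that is not itself a generator: the initial segment of `e` of length `ω ^ β`,
where `ω ^ β` is the leading power of `ω` in the Cantor normal form of `d e`. -/
noncomputable def headGen (e : Arrow Λ) (h : ¬ IsGen e) : Gen Λ :=
  ⟨Arrow.mk (split e.hom _ (log_le h)).2.1, Or.inr ⟨_, (split_spec e.hom _ (log_le h)).1⟩⟩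

/-- The rest of the path `e` after its segment `headGen e`. -/
noncomputable def tailPath (e : Arrow Λ) (h : ¬ IsGen e) : Arrow Λ :=
  Arrow.mk (split e.hom _ (log_le h)).2.2

theorem tailPath_lt (e : Arrow Λ) (h : ¬ IsGen e) : d (tailPath e h).hom < d e.hom := by
  obtain ⟨h1, h2⟩ := split_spec e.hom _ (log_le h)
  have h3 := d_comp (split e.hom _ (log_le h)).2.2 (split e.hom _ (log_le h)).2.1
  rw [h2, h1] at h3
  change d (split e.hom _ (log_le h)).2.2 < _
  generalize d (split e.hom _ (log_le h)).2.2 = t at h3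
  refine lt_of_le_of_ne (h3 ▸ le_add_self) ?_
  rintro rfl
  have h4 := Ordinal.add_eq_right_iff_mul_omega0_le.1 h3.symm
  rw [← Ordinal.opow_succ] at h4
  exact absurd (Ordinal.lt_opow_succ_log_self Ordinal.one_lt_omega0 _) (not_lt.2 h4)

/-- The element attached to an arbitrary path `e` by a family indexed by the generators: the product
of the elements attached to the pieces of `e` given by the Cantor normal form of `d e`. -/
noncomputable def pathElem {A : Type*} [Mul A] (T : Gen Λ → A) (e : Arrow Λ) : A :=
  open Classical in
  if h : IsGen e then T ⟨e, h⟩ else T (headGen e h) * pathElem T (tailPath e h)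
termination_by d e.hom
decreasing_by exact tailPath_lt e h

variable (Λ) in
/-- A Cuntz-Krieger family for `Λ` in a C*-algebra. The relation `star_mul_self` for vertices says
that each `T v` is a projection, hence each `T e` is a partial isometry. -/
structure CKFamily (A : Type*) [NonUnitalCStarAlgebra A] where
  /-- the elements of the family -/
  T : Gen Λ → A
  star_mul_self : ∀ e : Gen Λ, star (T e) * T e = T (Gen.vertex e.1.left)
  mul_of_lt : ∀ {x y z : Λ} (f : x ⟶ y) (e : y ⟶ z) (he : IsGen (Arrow.mk e))
    (hf : IsGen (Arrow.mk f)) (h : d e < d f),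
    T ⟨Arrow.mk e, he⟩ * T ⟨Arrow.mk f, hf⟩ = T ⟨Arrow.mk (f ≫ e), IsGen.comp f e hf h⟩
  star_mul_of_disjoint : ∀ e f : Gen Λ, extensions e.1 ∩ extensions f.1 = ∅ →
    star (T e) * T f = 0
  sum_regular : ∀ (v : Λ) (β : Ordinal.{u}), IsRegular v β →
    T (Gen.vertex v) = ∑ᶠ p : PathsTo v (ω ^ β), T (Gen.ofPath p) * star (T (Gen.ofPath p))

theorem CKFamily.norm_le_one {A : Type*} [NonUnitalCStarAlgebra A] (S : CKFamily Λ A)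
    (e : Gen Λ) : ‖S.T e‖ ≤ 1 := by
  have key : ∀ v : Λ, ‖S.T (Gen.vertex v)‖ ≤ 1 := fun v => by
    have h := CStarRing.norm_star_mul_self (x := S.T (Gen.vertex v))
    rw [S.star_mul_self] at h
    change ‖S.T (Gen.vertex v)‖ = _ at h
    nlinarith [norm_nonneg (S.T (Gen.vertex v))]
  have h := CStarRing.norm_star_mul_self (x := S.T e)
  rw [S.star_mul_self] at h
  nlinarith [norm_nonneg (S.T e), key e.1.left]

end Basic

section Algebra

variable (Λ : Type u) [SmallCategory Λ] [OrdinalGraph Λ]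

/-- A C*-algebra with a Cuntz-Krieger family for `Λ`. Carriers in `Type u` suffice: a C*-algebra
generated by a `Λ`-indexed family has cardinality at most `max |Λ| (2 ^ ℵ₀)`, so it is isomorphic
to one in `Type u`. -/
structure CKRep where
  carrier : Type u
  [inst : NonUnitalCStarAlgebra carrier]
  family : CKFamily Λ carrier

attribute [instance] CKRep.inst

/-- The bounded product of all C*-algebras that carry a Cuntz-Krieger family for `Λ`. -/
abbrev Ambient : Type (u + 1) := lp (fun i : CKRep Λ => i.carrier) ∞

variable {Λ} in
/-- The universal Cuntz-Krieger family inside the bounded product. -/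
noncomputable def ambientGen (e : Gen Λ) : Ambient Λ :=
  ⟨fun i => i.family.T e, memℓp_infty ⟨1, by
    rintro _ ⟨i, rfl⟩
    exact i.family.norm_le_one e⟩⟩

/-- `𝒪(Λ)`: the universal C*-algebra for Cuntz-Krieger families for `Λ`, constructed as the
C*-algebra generated by the universal family in the bounded product of all families. -/
noncomputable def algebraO : NonUnitalStarSubalgebra ℂ (Ambient Λ) :=
  (NonUnitalStarAlgebra.adjoin ℂ (Set.range (ambientGen (Λ := Λ)))).topologicalClosure

/-- `𝒪(Λ)` as a type. -/
abbrev O : Type (u + 1) := algebraO Λ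

noncomputable instance : NonUnitalCStarAlgebra (O Λ) :=
  NonUnitalStarSubalgebra.nonUnitalCStarAlgebra (algebraO Λ)
    (h_closed := NonUnitalStarSubalgebra.isClosed_topologicalClosure _)

variable {Λ}

/-- The generators `T_e` of `𝒪(Λ)`. -/
noncomputable def gen (e : Gen Λ) : O Λ :=
  ⟨ambientGen e, NonUnitalStarSubalgebra.le_topologicalClosure _
    (NonUnitalStarAlgebra.subset_adjoin ℂ _ ⟨e, rfl⟩)⟩

/-- The element `T_e` of `𝒪(Λ)` for an arbitrary path `e`. -/
noncomputable def pathT {x y : Λ} (e : x ⟶ y) : O Λ := pathElem gen (Arrow.mk e)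

/-- Evaluation of `𝒪(Λ)` at a C*-algebra with a Cuntz-Krieger family. -/
noncomputable def evalAt (i : CKRep Λ) : O Λ →⋆ₙₐ[ℂ] i.carrier where
  toFun a := a.1 i
  map_smul' _ _ := rfl
  map_zero' := rfl
  map_add' _ _ := rfl
  map_mul' _ _ := rfl
  map_star' _ := rfl

theorem evalAt_ext {a b : O Λ} (h : ∀ i, evalAt i a = evalAt i b) : a = b :=
  Subtype.ext (lp.ext (funext h))

/-- The generators of `𝒪(Λ)` form a Cuntz-Krieger family. -/
noncomputable def genFamily : CKFamily Λ (O Λ) where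
  T := gen
  star_mul_self e := evalAt_ext fun i => by
    rw [map_mul, map_star]; exact i.family.star_mul_self e
  mul_of_lt f e he hf h := evalAt_ext fun i => by
    rw [map_mul]; exact i.family.mul_of_lt f e he hf h
  star_mul_of_disjoint e f h := evalAt_ext fun i => by
    rw [map_mul, map_star, map_zero]; exact i.family.star_mul_of_disjoint e f h
  sum_regular v β h := evalAt_ext fun i => by
    have : Finite (PathsTo v (ω ^ β)) := h.2
    have := Fintype.ofFinite (PathsTo v (ω ^ β))
    rw [finsum_eq_sum_of_fintype, map_sum]
    refine (i.family.sum_regular v β h).trans ?_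
    rw [finsum_eq_sum_of_fintype]
    refine Finset.sum_congr rfl fun p _ => ?_
    rw [map_mul, map_star]; rfl

open scoped CStarAlgebra in
/-- The universal property of `𝒪(Λ)`. -/
theorem existsUnique_lift {A : Type u} [NonUnitalCStarAlgebra A] (S : CKFamily Λ A) :
    ∃! φ : O Λ →⋆ₙₐ[ℂ] A, ∀ e, φ (gen e) = S.T e := by
  refine ⟨evalAt ⟨A, S⟩, fun e => rfl, fun φ hφ => ?_⟩
  have hcl : IsClosed {a : O Λ | φ a = evalAt ⟨A, S⟩ a} :=
    isClosed_eq (map_continuous φ) (map_continuous (evalAt (⟨A, S⟩ : CKRep Λ)))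
  have hd : Dense (X := O Λ)
      {a | a.1 ∈ NonUnitalStarAlgebra.adjoin ℂ (Set.range (ambientGen (Λ := Λ)))} := by
    rw [Subtype.dense_iff]
    intro a ha
    refine closure_mono ?_ ha
    intro b hb
    exact ⟨⟨b, NonUnitalStarSubalgebra.le_topologicalClosure _ hb⟩, hb, rfl⟩
  have hsub : ∀ (a : Ambient Λ)
      (_ : a ∈ NonUnitalStarAlgebra.adjoin ℂ (Set.range (ambientGen (Λ := Λ))))
      (h : a ∈ algebraO Λ), φ ⟨a, h⟩ = evalAt ⟨A, S⟩ ⟨a, h⟩ := by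
    intro a ha
    induction ha using NonUnitalStarAlgebra.adjoin_induction with
    | mem x hx => obtain ⟨e, rfl⟩ := hx; exact fun h => hφ e
    | add x y hx hy h1 h2 =>
      intro h
      have e1 := h1 (NonUnitalStarSubalgebra.le_topologicalClosure _ hx)
      have e2 := h2 (NonUnitalStarSubalgebra.le_topologicalClosure _ hy)
      exact (map_add φ ⟨x, _⟩ ⟨y, _⟩).trans (congrArg₂ (· + ·) e1 e2)
    | zero => exact fun h => (map_zero φ).trans rfl
    | mul x y hx hy h1 h2 =>
      intro h
      have e1 := h1 (NonUnitalStarSubalgebra.le_topologicalClosure _ hx)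
      have e2 := h2 (NonUnitalStarSubalgebra.le_topologicalClosure _ hy)
      exact (map_mul φ ⟨x, _⟩ ⟨y, _⟩).trans (congrArg₂ (· * ·) e1 e2)
    | smul r x hx h1 =>
      intro h
      have e1 := h1 (NonUnitalStarSubalgebra.le_topologicalClosure _ hx)
      exact (map_smul φ r ⟨x, _⟩).trans (congrArg (r • ·) e1)
    | star x hx h1 =>
      intro h
      have e1 := h1 (NonUnitalStarSubalgebra.le_topologicalClosure _ hx)
      exact (map_star φ ⟨x, _⟩).trans (congrArg star e1)
  refine DFunLike.ext _ _ fun a => ?_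
  exact hcl.closure_subset_iff.2 (fun b hb => hsub b.1 hb b.2) (hd a)

end Algebra

section Truncation

variable (Λ : Type u) [SmallCategory Λ] [OrdinalGraph Λ]

/-- The property of a path to be shorter than `ω ^ γ`. -/
def below (γ : Ordinal.{u}) : MorphismProperty Λ := fun _ _ f => d f < ω ^ γ

instance (γ : Ordinal.{u}) : (below Λ γ).IsMultiplicative where
  id_mem x := by
    change d (𝟙 x) < _
    rw [d_id]
    exact Ordinal.opow_pos _ Ordinal.omega0_pos
  comp_mem f g hf hg := by
    change d (f ≫ g) < _
    rw [d_comp]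
    exact Ordinal.isPrincipal_add_omega0_opow γ hg hf

/-- `Λ_γ`: the category with the same vertices as `Λ` and with the paths shorter than `ω ^ γ`. -/
abbrev Trunc (γ : Ordinal.{u}) : Type u := WideSubcategory (below Λ γ)

variable {Λ}

instance (γ : Ordinal.{u}) : OrdinalGraph (Trunc Λ γ) where
  d f := d f.hom
  d_id x := d_id x.obj
  d_comp f e := d_comp f.hom e.hom
  factor {x y} e α h := by
    obtain ⟨⟨z, p, q⟩, ⟨h1, h2⟩, h3⟩ := factor e.hom α h
    dsimp only at h1 h2
    have hd : d e.hom = d p + d q := by rw [← h2, d_comp]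
    have hlt : d e.hom < ω ^ γ := e.property
    have hp : below Λ γ p := lt_of_le_of_lt (hd ▸ le_self_add) hlt
    have hq : below Λ γ q := lt_of_le_of_lt (hd ▸ le_add_self) hlt
    refine ⟨⟨⟨z⟩, ⟨p, hp⟩, ⟨q, hq⟩⟩, ⟨h1, WideSubcategory.hom_ext _ h2⟩, ?_⟩
    rintro ⟨⟨z'⟩, ⟨p', hp'⟩, ⟨q', hq'⟩⟩ ⟨h1', h2'⟩
    have := h3 ⟨z', p', q'⟩ ⟨h1', congrArg InducedWideCategory.Hom.hom h2'⟩
    cases this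
    rfl

/-- The inclusion of the generators of `Λ_γ` into those of `Λ`. -/
def inclGen {γ : Ordinal.{u}} (e : Gen (Trunc Λ γ)) : Gen Λ :=
  ⟨Arrow.mk e.1.hom.hom, e.2⟩

theorem comparable {y y' x z : Λ} (e : y ⟶ z) (f : y' ⟶ z) (g : x ⟶ y) (h : x ⟶ y')
    (hef : g ≫ e = h ≫ f) (hd : d e ≤ d f) : ∃ q : y' ⟶ y, q ≫ e = f := by
  obtain ⟨⟨w, p, q⟩, ⟨h1, h2⟩, -⟩ := factor f (d e) hd
  dsimp only at h1 h2
  have hle : d e ≤ d (g ≫ e) := by rw [d_comp]; exact le_self_add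
  have := (factor (g ≫ e) (d e) hle).unique (y₁ := ⟨w, p, h ≫ q⟩) (y₂ := ⟨y, e, g⟩)
    ⟨h1, by dsimp only; rw [Category.assoc, h2, hef]⟩ ⟨rfl, rfl⟩
  cases this
  exact ⟨q, h2⟩

theorem mem_extensions_of_le {γ : Ordinal.{u}} (e f : Arrow (Trunc Λ γ)) (b : Arrow Λ)
    (he : b ∈ extensions (Arrow.mk e.hom.hom)) (hf : b ∈ extensions (Arrow.mk f.hom.hom))
    (hd : d e.hom ≤ d f.hom) : f ∈ extensions e := by
  obtain ⟨⟨y⟩, ⟨z⟩, ⟨e, he'⟩⟩ := e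
  obtain ⟨⟨y'⟩, ⟨z'⟩, ⟨f, hf'⟩⟩ := f
  obtain ⟨x, g, rfl⟩ := he
  obtain ⟨x', h, hh⟩ := hf
  have hx : x = x' := congrArg Comma.left hh
  have hz : z = z' := congrArg Comma.right hh
  subst hx hz
  obtain ⟨q, hq⟩ := comparable e f g h ((Arrow.mk_inj _ _).1 hh) hd
  have hq' : below Λ γ q := by
    refine lt_of_le_of_lt ?_ hf'
    rw [← hq, d_comp]
    exact le_add_self
  refine ⟨⟨y'⟩, ⟨q, hq'⟩, ?_⟩
  subst hq
  rfl

theorem mem_extensions_self {γ : Ordinal.{u}} (e : Arrow (Trunc Λ γ)) : e ∈ extensions e :=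
  ⟨e.left, 𝟙 _, by rw [Category.id_comp]; rfl⟩

theorem disjoint_inclGen {γ : Ordinal.{u}} (e f : Gen (Trunc Λ γ))
    (h : extensions e.1 ∩ extensions f.1 = ∅) :
    extensions (inclGen e).1 ∩ extensions (inclGen f).1 = ∅ := by
  by_contra hne
  obtain ⟨b, hb1, hb2⟩ := Set.nonempty_iff_ne_empty.2 hne
  rcases le_total (d e.1.hom) (d f.1.hom) with hd | hd
  · exact Set.notMem_empty _ (h ▸ ⟨mem_extensions_of_le e.1 f.1 b hb1 hb2 hd,
      mem_extensions_self f.1⟩ : f.1 ∈ (∅ : Set _))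
  · exact Set.notMem_empty _ (h ▸ ⟨mem_extensions_self e.1,
      mem_extensions_of_le f.1 e.1 b hb2 hb1 hd⟩ : e.1 ∈ (∅ : Set _))

/-- Paths of length `β < ω ^ γ` are the same in `Λ_γ` and in `Λ`. -/
def pathsEquiv {γ : Ordinal.{u}} (v : Trunc Λ γ) (β : Ordinal.{u}) (hβ : β < ω ^ γ) :
    PathsTo v β ≃ PathsTo v.obj β where
  toFun p := ⟨p.1.obj, p.2.1.hom, p.2.2⟩
  invFun p := ⟨⟨p.1⟩, ⟨p.2.1, lt_of_eq_of_lt p.2.2 hβ⟩, p.2.2⟩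
  left_inv _ := rfl
  right_inv _ := rfl

theorem IsRegular.opow_lt {γ : Ordinal.{u}} {v : Trunc Λ γ} {β : Ordinal.{u}}
    (h : IsRegular v β) : ω ^ β < ω ^ γ := by
  obtain ⟨x, f, hf⟩ := h.1 v (𝟙 v) (by rw [d_id]; exact Ordinal.opow_pos _ Ordinal.omega0_pos)
  exact hf ▸ f.property

theorem IsRegular.obj {γ : Ordinal.{u}} {v : Trunc Λ γ} {β : Ordinal.{u}}
    (h : IsRegular v β) : IsRegular v.obj β := by
  have hlt := h.opow_lt
  refine ⟨fun x e he => ?_, ?_⟩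
  · exact (h.1 ⟨x⟩ ⟨e, he.trans hlt⟩ he).map (pathsEquiv _ _ hlt)
  · have : Finite (PathsTo v (ω ^ β)) := h.2
    exact Finite.of_equiv _ (pathsEquiv v _ hlt)

/-- A Cuntz-Krieger family for `Λ` restricts to one for `Λ_γ`. -/
def CKFamily.restrict {A : Type*} [NonUnitalCStarAlgebra A] (S : CKFamily Λ A)
    (γ : Ordinal.{u}) : CKFamily (Trunc Λ γ) A where
  T e := S.T (inclGen e)
  star_mul_self e := S.star_mul_self (inclGen e)
  mul_of_lt f e he hf h := S.mul_of_lt f.hom e.hom he hf h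
  star_mul_of_disjoint e f h := S.star_mul_of_disjoint _ _ (disjoint_inclGen e f h)
  sum_regular v β h := by
    refine (S.sum_regular v.obj β h.obj).trans ?_
    exact (finsum_comp_equiv (pathsEquiv v (ω ^ β) h.opow_lt)
      (f := fun p => S.T (Gen.ofPath p) * star (S.T (Gen.ofPath p)))).symm

/-- A C*-algebra with a Cuntz-Krieger family for `Λ` as one with a family for `Λ_γ`. -/
def CKRep.restrict (γ : Ordinal.{u}) (i : CKRep Λ) : CKRep (Trunc Λ γ) :=
  ⟨i.carrier, i.family.restrict γ⟩

/-- The map of bounded products that is induced by restricting families. -/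
noncomputable def ambientMap (γ : Ordinal.{u}) : Ambient (Trunc Λ γ) →⋆ₙₐ[ℂ] Ambient Λ where
  toFun a := ⟨fun i => a (i.restrict γ), memℓp_infty ⟨‖a‖, by
    rintro _ ⟨i, rfl⟩
    exact lp.norm_apply_le_norm ENNReal.top_ne_zero a (i.restrict γ)⟩⟩
  map_smul' _ _ := rfl
  map_zero' := rfl
  map_add' _ _ := rfl
  map_mul' _ _ := rfl
  map_star' _ := rfl

open scoped CStarAlgebra in
theorem ambientMap_mem (γ : Ordinal.{u}) (a : O (Trunc Λ γ)) :
    ambientMap γ a.1 ∈ algebraO Λ := by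
  have hle : algebraO (Trunc Λ γ) ≤ (algebraO Λ).comap (ambientMap γ) := by
    refine NonUnitalStarSubalgebra.topologicalClosure_minimal _ ?_ ?_
    · refine NonUnitalStarAlgebra.adjoin_le ?_
      rintro _ ⟨e, rfl⟩
      exact (gen (inclGen e)).2
    · exact (NonUnitalStarSubalgebra.isClosed_topologicalClosure _).preimage
        (map_continuous (ambientMap (Λ := Λ) γ))
  exact hle a.2

/-- The connecting *-homomorphism `ρ_γ : 𝒪(Λ_γ) → 𝒪(Λ)`. -/
noncomputable def rho (γ : Ordinal.{u}) : O (Trunc Λ γ) →⋆ₙₐ[ℂ] O Λ where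
  toFun a := ⟨ambientMap γ a.1, ambientMap_mem γ a⟩
  map_smul' _ _ := rfl
  map_zero' := rfl
  map_add' _ _ := rfl
  map_mul' _ _ := rfl
  map_star' _ := rfl

/-- `ρ_γ` maps each generator of `𝒪(Λ_γ)` to the corresponding generator of `𝒪(Λ)`. -/
theorem rho_gen {γ : Ordinal.{u}} (e : Gen (Trunc Λ γ)) : rho γ (gen e) = gen (inclGen e) := rfl

end Truncation

/-- `powSucc a n` is the power `a ^ (n + 1)` in an algebra that need not have a unit. -/
def powSucc {A : Type*} [Mul A] (a : A) : ℕ → A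
  | 0 => a
  | n + 1 => powSucc a n * a

end OrdGraph

/-! In `𝒪(Λ)` the element `T_g` acts by composition on the paths `p` with range `v` and length `ω ^
(α + 1)`: every Cantor piece of `g` is shorter than `p`, so relation (2) absorbs the pieces one by
one and `T_g T_p = T_{gp}`. By unique factorization `p ↦ gp` is injective, and by regularity of `v`
it acts on a finite set, so it is a permutation and some positive power of it is the identity.
Inserting `T_v = ∑ T_p T_p^*` shows that the same power of `T_g` is `T_v`
(`CKFamily.exists_powSucc_eq_vertex`).

In `𝒪(Λ_{α+1})` no positive power of `S_g` is `S_v`. To see this, let the paths act on maximal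
chains of paths (boundary paths) paired with an integer that increases by one for each piece of
length `ω ^ α`. This gives a Cuntz-Krieger family on an `ℓ²` space: (4) holds because at a regular
vertex every maximal chain passes through a path of the required length (`exists_mem_of_isRegular`),
and the integer respects (2) because in `Λ_{α+1}` no generator is longer than `ω ^ α`, so relation
(2) never absorbs such a piece. As `d g ≥ ω ^ α`, each positive power of `S_g` moves the integer
strictly upwards, whereas `S_v` fixes it. -/

namespace OrdGraph

open OrdinalGraph

/-! ### Path elements in Cuntz-Krieger families and powers of a short closed path -/

section PathElem

variable {Λ : Type u} [SmallCategory Λ] [OrdinalGraph Λ]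

theorem pathElem_of_isGen {A : Type*} [Mul A] (T : Gen Λ → A) (e : Arrow Λ) (h : IsGen e) :
    pathElem T e = T ⟨e, h⟩ := by
  rw [pathElem, dif_pos h]

theorem pathElem_of_not_isGen {A : Type*} [Mul A] (T : Gen Λ → A) (e : Arrow Λ)
    (h : ¬ IsGen e) : pathElem T e = T (headGen e h) * pathElem T (tailPath e h) := by
  rw [pathElem, dif_neg h]

theorem tailPath_comp_headGen (e : Arrow Λ) (h : ¬ IsGen e) :
    (show e.left ⟶ (split e.hom _ (log_le h)).1 from (tailPath e h).hom) ≫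
      (show (split e.hom _ (log_le h)).1 ⟶ e.right from (headGen e h).1.hom) = e.hom :=
  (split_spec e.hom _ (log_le h)).2

/-- Induction along the Cantor normal form of the length of a path. -/
theorem path_induction {P : Arrow Λ → Prop} (gen : ∀ e, IsGen e → P e)
    (cons : ∀ (e : Arrow Λ) (h : ¬ IsGen e), P (tailPath e h) → P e) (e : Arrow Λ) : P e := by
  by_cases h : IsGen e
  · exact gen e h
  · exact cons e h (path_induction gen cons (tailPath e h))
termination_by d e.hom
decreasing_by exact tailPath_lt e h

theorem map_pathElem {A B F : Type*} [Mul A] [Mul B] [FunLike F A B] [MulHomClass F A B]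
    (φ : F) (T : Gen Λ → A) (e : Arrow Λ) :
    φ (pathElem T e) = pathElem (fun e => φ (T e)) e := by
  induction e using path_induction with
  | gen e h => rw [pathElem_of_isGen _ _ h, pathElem_of_isGen _ _ h]
  | cons e h ih =>
    rw [pathElem_of_not_isGen _ _ h, pathElem_of_not_isGen _ _ h, map_mul, ih]

theorem map_powSucc {A B F : Type*} [Mul A] [Mul B] [FunLike F A B] [MulHomClass F A B]
    (φ : F) (a : A) (n : ℕ) : φ (powSucc a n) = powSucc (φ a) n := by
  induction n with
  | zero => rfl
  | succ n ih => rw [powSucc, map_mul, ih, powSucc]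

variable {A : Type*} [NonUnitalCStarAlgebra A]

theorem CKFamily.star_vertex (S : CKFamily Λ A) (v : Λ) :
    star (S.T (Gen.vertex v)) = S.T (Gen.vertex v) := by
  have h : star (S.T (Gen.vertex v)) * S.T (Gen.vertex v) = S.T (Gen.vertex v) :=
    S.star_mul_self (Gen.vertex v)
  rw [← h, star_mul, star_star]

theorem CKFamily.vertex_mul_self (S : CKFamily Λ A) (v : Λ) :
    S.T (Gen.vertex v) * S.T (Gen.vertex v) = S.T (Gen.vertex v) := by
  have h : star (S.T (Gen.vertex v)) * S.T (Gen.vertex v) = S.T (Gen.vertex v) :=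
    S.star_mul_self (Gen.vertex v)
  rwa [S.star_vertex] at h

theorem mul_eq_self_of_star_mul_self {a p : A} (hs : star p = p) (hp : p * p = p)
    (h : star a * a = p) : a * p = a := by
  rw [← sub_eq_zero, ← CStarRing.star_mul_self_eq_zero_iff]
  calc star (a * p - a) * (a * p - a)
      = p * (star a * a) * p - p * (star a * a) - (star a * a) * p + star a * a := by
        rw [star_sub, star_mul, hs]; noncomm_ring
    _ = 0 := by rw [h]; simp only [hp, sub_self, zero_sub, neg_add_cancel]

theorem CKFamily.mul_vertex (S : CKFamily Λ A) (e : Gen Λ) :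
    S.T e * S.T (Gen.vertex e.1.left) = S.T e :=
  mul_eq_self_of_star_mul_self (S.star_vertex _) (S.vertex_mul_self _) (S.star_mul_self e)

theorem CKFamily.pathElem_mul_vertex (S : CKFamily Λ A) (e : Arrow Λ) :
    pathElem S.T e * S.T (Gen.vertex e.left) = pathElem S.T e := by
  induction e using path_induction with
  | gen e h =>
    rw [pathElem_of_isGen _ _ h]
    exact S.mul_vertex ⟨e, h⟩
  | cons e h ih =>
    rw [pathElem_of_not_isGen _ _ h, mul_assoc]
    exact congrArg _ ih

theorem CKFamily.powSucc_pathElem_mul_vertex (S : CKFamily Λ A) {v : Λ} (g : v ⟶ v) (n : ℕ) :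
    powSucc (pathElem S.T (Arrow.mk g)) n * S.T (Gen.vertex v)
      = powSucc (pathElem S.T (Arrow.mk g)) n := by
  cases n with
  | zero => exact S.pathElem_mul_vertex (Arrow.mk g)
  | succ n =>
    rw [powSucc, mul_assoc]
    exact congrArg _ (S.pathElem_mul_vertex (Arrow.mk g))

theorem d_comp_of_lt_opow {γ : Ordinal.{u}} {x y z : Λ} {f : x ⟶ y} {g : y ⟶ z}
    (hf : d f = ω ^ γ) (hg : d g < ω ^ γ) : d (f ≫ g) = ω ^ γ := by
  rw [d_comp, hf, Ordinal.add_omega0_opow hg]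

/-- All Cantor pieces of `e` are shorter than `ω ^ γ`. The tail is absorbed into `f` by induction,
which leaves the length at `ω ^ γ`, and relation (2) then absorbs the head. -/
theorem CKFamily.pathElem_restrict_mul (S : CKFamily Λ A) {γ : Ordinal.{u}}
    (e : Arrow (Trunc Λ γ)) {w : Λ} (f : w ⟶ e.left.obj) (hf : d f = ω ^ γ) :
    pathElem (S.restrict γ).T e * S.T ⟨Arrow.mk f, Or.inr ⟨γ, hf⟩⟩ =
      S.T ⟨Arrow.mk (f ≫ e.hom.hom), Or.inr ⟨γ, d_comp_of_lt_opow hf e.hom.property⟩⟩ := by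
  induction e using path_induction with
  | gen e h =>
    rw [pathElem_of_isGen _ _ h]
    exact S.mul_of_lt f e.hom.hom h _ (lt_of_lt_of_eq e.hom.property hf.symm)
  | cons e h ih =>
    rw [pathElem_of_not_isGen _ _ h, mul_assoc]
    refine (congrArg _ (ih f hf)).trans ?_
    have h1 : d (f ≫ (tailPath e h).hom.hom) = ω ^ γ :=
      d_comp_of_lt_opow hf (tailPath e h).hom.property
    refine (S.mul_of_lt (f ≫ (tailPath e h).hom.hom) (headGen e h).1.hom.hom (headGen e h).2
      (Or.inr ⟨γ, h1⟩) (lt_of_lt_of_eq (headGen e h).1.hom.property h1.symm)).trans ?_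
    have h2 := congrArg InducedWideCategory.Hom.hom (tailPath_comp_headGen e h)
    congr 1
    refine Subtype.ext (congrArg Arrow.mk ?_)
    exact (Category.assoc _ _ _).trans (congrArg (f ≫ ·) h2)

/-- Cancellation: a path has only one factorization whose initial segment has length `d g`. -/
theorem comp_right_injective {x y z : Λ} (g : y ⟶ z) :
    Function.Injective fun f : x ⟶ y => f ≫ g := by
  intro f f' h
  have hle : d g ≤ d (f ≫ g) := by rw [d_comp]; exact le_self_add
  have := (factor (f ≫ g) (d g) hle).unique (y₁ := ⟨y, g, f⟩) (y₂ := ⟨y, g, f'⟩)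
    ⟨rfl, rfl⟩ ⟨rfl, h.symm⟩
  cases this
  rfl

/-- Composition with a shorter path on the paths of length `ω ^ γ`. -/
def PathsTo.push {γ : Ordinal.{u}} {v v' : Λ} (g : v ⟶ v') (hg : d g < ω ^ γ)
    (p : PathsTo v (ω ^ γ)) : PathsTo v' (ω ^ γ) :=
  ⟨p.1, p.2.1 ≫ g, d_comp_of_lt_opow p.2.2 hg⟩

theorem PathsTo.push_injective {γ : Ordinal.{u}} {v v' : Λ} (g : v ⟶ v') (hg : d g < ω ^ γ) :
    Function.Injective (PathsTo.push (γ := γ) g hg) := by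
  rintro ⟨x, p, hp⟩ ⟨x', p', hp'⟩ h
  obtain rfl : x = x' := congrArg Sigma.fst h
  have h1 : p ≫ g = p' ≫ g := congrArg Subtype.val (eq_of_heq (Sigma.ext_iff.1 h).2)
  obtain rfl := comp_right_injective g h1
  rfl

theorem _root_.Finite.exists_iterate_succ_eq_self {ι : Type*} [Finite ι] {σ : ι → ι}
    (hσ : Function.Injective σ) : ∃ n : ℕ, ∀ i, σ^[n + 1] i = i := by
  let τ : Equiv.Perm ι := Equiv.ofBijective σ (Finite.injective_iff_bijective.1 hσ)
  obtain ⟨n, hn, h⟩ := isOfFinOrder_iff_pow_eq_one.1 (isOfFinOrder_of_finite τ)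
  -- The order is positive; the shift by one matches `powSucc a n`, which stands for the power `n +
  -- 1`.
  refine ⟨n - 1, fun i => ?_⟩
  rw [Nat.sub_add_cancel hn]
  have := congrArg (fun τ : Equiv.Perm ι => τ i) h
  simpa [Equiv.Perm.coe_pow, Equiv.Perm.iterate_eq_pow, τ] using this

/-- A power of a closed path that is shorter than `ω ^ γ` becomes trivial in every Cuntz-Krieger
family if the base point is `γ`-regular. -/
theorem CKFamily.exists_powSucc_eq_vertex {v : Λ} {γ : Ordinal.{u}} (hv : IsRegular v γ)
    (g : v ⟶ v) (hg : d g < ω ^ γ) : ∃ n : ℕ, ∀ S : CKFamily Λ A,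
      powSucc (pathElem (S.restrict γ).T
        (Arrow.mk (⟨g, hg⟩ : (⟨v⟩ : Trunc Λ γ) ⟶ ⟨v⟩))) n = S.T (Gen.vertex v) := by
  have : Finite (PathsTo v (ω ^ γ)) := hv.2
  have := Fintype.ofFinite (PathsTo v (ω ^ γ))
  -- The exponent comes from the permutation of paths alone, so one `n` serves all families `S`.
  obtain ⟨n, hn⟩ := Finite.exists_iterate_succ_eq_self (PathsTo.push_injective (γ := γ) g hg)
  refine ⟨n, fun S => ?_⟩
  set a := pathElem (S.restrict γ).T (Arrow.mk (⟨g, hg⟩ : (⟨v⟩ : Trunc Λ γ) ⟶ ⟨v⟩))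
  have h1 : ∀ p : PathsTo v (ω ^ γ),
      a * S.T (Gen.ofPath p) = S.T (Gen.ofPath (p.push g hg)) := fun p =>
    S.pathElem_restrict_mul (Arrow.mk (⟨g, hg⟩ : (⟨v⟩ : Trunc Λ γ) ⟶ ⟨v⟩)) p.2.1 p.2.2
  have h2 : ∀ (m : ℕ) (p : PathsTo v (ω ^ γ)),
      powSucc a m * S.T (Gen.ofPath p) = S.T (Gen.ofPath ((PathsTo.push g hg)^[m + 1] p)) := by
    intro m
    induction m with
    | zero => exact h1
    | succ m ih => intro p; rw [powSucc, mul_assoc, h1, ih, ← Function.iterate_succ_apply]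
  have h3 : powSucc a n * S.T (Gen.vertex v) = powSucc a n :=
    (S.restrict γ).powSucc_pathElem_mul_vertex (v := ⟨v⟩) ⟨g, hg⟩ n
  -- The power is multiplied by `T_v = ∑ T_p T_p^*`, and it fixes each `T_p`.
  rw [← h3, S.sum_regular v γ hv, finsum_eq_sum_of_fintype, Finset.mul_sum]
  refine Finset.sum_congr rfl fun p _ => ?_
  rw [← mul_assoc, h2, hn]

end PathElem

/-! ### Partial isometries of `ℓ²` from bi-unique relations -/

section RelOperator

variable {Y : Type u}

open Classical in
/-- Transport of a function along a relation; it is meant for bi-unique relations. -/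
noncomputable def relFun (R : Y → Y → Prop) (ξ : Y → ℂ) (b : Y) : ℂ :=
  if h : ∃ a, R a b then ξ h.choose else 0

theorem relFun_of_rel {R : Y → Y → Prop} (hR : Relator.BiUnique R) (ξ : Y → ℂ) {a b : Y}
    (h : R a b) : relFun R ξ b = ξ a := by
  have h' : ∃ a, R a b := ⟨a, h⟩
  rw [relFun, dif_pos h', hR.1 h'.choose_spec h]

theorem relFun_of_not {R : Y → Y → Prop} (ξ : Y → ℂ) {b : Y} (h : ∀ a, ¬ R a b) :
    relFun R ξ b = 0 := by
  rw [relFun, dif_neg (not_exists.2 h)]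

/-- Points without a predecessor contribute nothing; on the others, taking the predecessor is
injective, so the sum is a finite partial sum of the norm of `ξ`. -/
theorem sum_norm_relFun_le {R : Y → Y → Prop} (hR : Relator.BiUnique R)
    (ξ : lp (fun _ : Y => ℂ) 2) (s : Finset Y) :
    ∑ b ∈ s, ‖relFun R ξ b‖ ^ (2 : ℝ≥0∞).toReal ≤ ‖ξ‖ ^ (2 : ℝ≥0∞).toReal := by
  classical
  have h0 : (0 : ℝ) < (2 : ℝ≥0∞).toReal := by norm_num
  let t := s.filter fun b => ∃ a, R a b
  have ht : ∀ b ∈ t, ∃ a, R a b := fun b hb => (Finset.mem_filter.1 hb).2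
  -- The default value `b` is never used on `t`.
  let g : Y → Y := fun b => if h : ∃ a, R a b then h.choose else b
  have hg : ∀ b ∈ t, R (g b) b := fun b hb => by
    simp only [g, dif_pos (ht b hb)]
    exact (ht b hb).choose_spec
  calc ∑ b ∈ s, ‖relFun R ξ b‖ ^ (2 : ℝ≥0∞).toReal
      = ∑ b ∈ t, ‖relFun R ξ b‖ ^ (2 : ℝ≥0∞).toReal := by
        refine (Finset.sum_subset (Finset.filter_subset _ _) fun b hb hbt => ?_).symm
        rw [relFun_of_not _ fun a ha => hbt (Finset.mem_filter.2 ⟨hb, a, ha⟩), norm_zero,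
          Real.zero_rpow h0.ne']
    _ = ∑ b ∈ t, ‖ξ (g b)‖ ^ (2 : ℝ≥0∞).toReal :=
        Finset.sum_congr rfl fun b hb => by rw [relFun_of_rel hR _ (hg b hb)]
    _ = ∑ a ∈ t.image g, ‖ξ a‖ ^ (2 : ℝ≥0∞).toReal := by
        refine (Finset.sum_image (f := fun a => ‖ξ a‖ ^ (2 : ℝ≥0∞).toReal)
          fun b hb b' hb' h => ?_).symm
        have h' := hg b' hb'
        rw [← h] at h'
        exact hR.2 (hg b hb) h'
    _ ≤ _ := lp.sum_rpow_le_norm_rpow h0 ξ _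

/-- The partial isometry of `ℓ²(Y)` that is induced by a bi-unique relation. -/
noncomputable def relOp (R : Y → Y → Prop) (hR : Relator.BiUnique R) :
    lp (fun _ : Y => ℂ) 2 →L[ℂ] lp (fun _ : Y => ℂ) 2 :=
  LinearMap.mkContinuous
    { toFun := fun ξ => ⟨relFun R ξ, memℓp_gen' (sum_norm_relFun_le hR ξ)⟩
      map_add' := fun ξ η => by
        ext b
        change relFun R (ξ + η : lp (fun _ : Y => ℂ) 2) b = relFun R ξ b + relFun R η b
        by_cases h : ∃ a, R a b
        · obtain ⟨a, h⟩ := h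
          simp only [relFun_of_rel hR _ h]
          rfl
        · simp only [relFun_of_not _ (not_exists.1 h), add_zero]
      map_smul' := fun c ξ => by
        ext b
        change relFun R (c • ξ : lp (fun _ : Y => ℂ) 2) b = c * relFun R ξ b
        by_cases h : ∃ a, R a b
        · obtain ⟨a, h⟩ := h
          simp only [relFun_of_rel hR _ h]
          rfl
        · simp only [relFun_of_not _ (not_exists.1 h), mul_zero] }
    1 fun ξ => by
      rw [one_mul]
      exact lp.norm_le_of_forall_sum_le (by norm_num) (norm_nonneg _) (sum_norm_relFun_le hR ξ)

theorem relOp_of_rel {R : Y → Y → Prop} (hR : Relator.BiUnique R)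
    (ξ : lp (fun _ : Y => ℂ) 2) {a b : Y} (h : R a b) : relOp R hR ξ b = ξ a :=
  relFun_of_rel hR ξ h

theorem relOp_of_not {R : Y → Y → Prop} (hR : Relator.BiUnique R)
    (ξ : lp (fun _ : Y => ℂ) 2) {b : Y} (h : ∀ a, ¬ R a b) : relOp R hR ξ b = 0 :=
  relFun_of_not ξ h

theorem biUnique_flip {R : Y → Y → Prop} (hR : Relator.BiUnique R) :
    Relator.BiUnique (flip R) :=
  ⟨fun _ _ _ h h' => hR.2 h h', fun _ _ _ h h' => hR.1 h h'⟩

theorem star_relOp (R : Y → Y → Prop) (hR : Relator.BiUnique R) :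
    star (relOp R hR) = relOp (flip R) (biUnique_flip hR) := by
  rw [ContinuousLinearMap.star_eq_adjoint]
  refine ((ContinuousLinearMap.eq_adjoint_iff _ _).2 fun ξ η => ?_).symm
  rw [lp.inner_eq_tsum, lp.inner_eq_tsum]
  have key : ∀ a : Function.support fun b => inner ℂ (ξ b) (relOp R hR η b),
      ∃ b, R b a := fun a => by
    by_contra h
    refine a.2 ?_
    simp only [relOp_of_not hR η (not_exists.1 h), inner_zero_right]
  choose i hi using key
  -- The two inner products are the same series, reindexed by sending a point of the support to its
  -- predecessor.
  refine tsum_eq_tsum_of_ne_zero_bij i (fun a b h => ?_) (fun b hb => ?_) fun a => ?_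
  · have hb := hi b
    rw [← h] at hb
    exact Subtype.ext (hR.2 (hi a) hb)
  · by_cases h : ∃ a, R b a
    · obtain ⟨a, h⟩ := h
      have ha : inner ℂ (ξ a) (relOp R hR η a) ≠ 0 := by
        rw [relOp_of_rel hR η h, ← relOp_of_rel (biUnique_flip hR) ξ (a := a) (b := b) h]
        exact hb
      exact ⟨⟨a, ha⟩, hR.1 (hi ⟨a, ha⟩) h⟩
    · refine absurd ?_ hb
      simp only [relOp_of_not (biUnique_flip hR) ξ (not_exists.1 h), inner_zero_left]
  · rw [relOp_of_rel hR η (hi a),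
      relOp_of_rel (biUnique_flip hR) ξ (a := (a : Y)) (b := i a) (hi a)]

/-- The basis vector of `ℓ²(Y)` at a point. -/
noncomputable def basisVec (a : Y) : lp (fun _ : Y => ℂ) 2 :=
  open Classical in lp.single 2 a 1

theorem basisVec_self (a : Y) : basisVec a a = 1 := by
  classical
  exact lp.single_apply_self 2 a _

theorem basisVec_ne {a b : Y} (h : b ≠ a) : basisVec a b = 0 := by
  classical
  exact lp.single_apply_ne 2 a _ h

theorem basisVec_injective : Function.Injective (basisVec : Y → _) := by
  intro a b h
  by_contra hab
  have := basisVec_self a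
  rw [h, basisVec_ne hab] at this
  exact zero_ne_one this

theorem relOp_basisVec {R : Y → Y → Prop} (hR : Relator.BiUnique R) {a b : Y} (h : R a b) :
    relOp R hR (basisVec a) = basisVec b := by
  ext c
  by_cases hc : c = b
  · subst hc
    rw [relOp_of_rel hR _ h, basisVec_self, basisVec_self]
  · rw [basisVec_ne hc]
    by_cases h' : ∃ a', R a' c
    · obtain ⟨a', h'⟩ := h'
      rw [relOp_of_rel hR _ h', basisVec_ne]
      rintro rfl
      exact hc (hR.2 h' h)
    · exact relOp_of_not hR _ (not_exists.1 h')

end RelOperator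

/-! ### Cuntz-Krieger families from actions on sets -/

section Action

variable {Λ : Type u} [SmallCategory Λ] [OrdinalGraph Λ]

variable (Λ) in
/-- A covering system of sets for `Λ`: each path `e` with source `x` and range `v` acts by an
injection of the set over `x` into the set over `v`. -/
structure BoundarySystem where
  /-- the set over a vertex -/
  carrier : Λ → Type u
  /-- the action of a path -/
  act : ∀ {x y : Λ}, (x ⟶ y) → carrier x → carrier y
  act_injective : ∀ {x y : Λ} (e : x ⟶ y), Function.Injective (act e)
  act_id : ∀ {x : Λ} (a : carrier x), act (𝟙 x) a = a
  -- Functoriality is asked only for the pairs in relation (2). The integer in `gradedBoundary` is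
  -- not additive on all composites: two pieces of length `ω ^ α` compose to a path that is counted
  -- as zero.
  act_comp : ∀ {x y z : Λ} (f : x ⟶ y) (e : y ⟶ z), IsGen (Arrow.mk e) →
    IsGen (Arrow.mk f) → d e < d f → ∀ a, act (f ≫ e) a = act e (act f a)
  comparable : ∀ {x y z : Λ} (e : x ⟶ z) (f : y ⟶ z) (a : carrier x) (b : carrier y),
    act e a = act f b → (extensions (Arrow.mk e) ∩ extensions (Arrow.mk f)).Nonempty
  covering : ∀ {v : Λ} {β : Ordinal.{u}}, IsRegular v β → ∀ a : carrier v,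
    ∃ (p : PathsTo v (ω ^ β)) (b : carrier p.1), act p.2.1 b = a

namespace BoundarySystem

variable (X : BoundarySystem Λ)

/-- The disjoint union of the sets over all vertices. -/
abbrev Total : Type u := Σ v, X.carrier v

/-- The action of an arrow as a relation on the disjoint union. -/
def rel (e : Arrow Λ) (a b : X.Total) : Prop :=
  ∃ c : X.carrier e.left, a = ⟨e.left, c⟩ ∧ b = ⟨e.right, X.act e.hom c⟩

theorem rel_biUnique (e : Arrow Λ) : Relator.BiUnique (X.rel e) := by
  constructor
  · rintro a b _ ⟨c, rfl, rfl⟩ ⟨c', rfl, h⟩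
    rw [X.act_injective e.hom (eq_of_heq (Sigma.ext_iff.1 h).2)]
  · rintro _ a b ⟨c, rfl, rfl⟩ ⟨c', h, rfl⟩
    rw [show c = c' from eq_of_heq (Sigma.ext_iff.1 h).2]

theorem rel_vertex {v : Λ} {a b : X.Total} :
    X.rel (Arrow.mk (𝟙 v)) a b ↔ a = b ∧ a.1 = v := by
  constructor
  · rintro ⟨c, rfl, rfl⟩
    exact ⟨congrArg (Sigma.mk v) (X.act_id c).symm, rfl⟩
  · obtain ⟨x, a⟩ := a
    rintro ⟨rfl, rfl⟩
    exact ⟨a, rfl, congrArg (Sigma.mk x) (X.act_id a).symm⟩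

/-- The operator on the `ℓ²`-space of the disjoint union that is attached to an arrow. -/
noncomputable def op (e : Arrow Λ) :
    lp (fun _ : X.Total => ℂ) 2 →L[ℂ] lp (fun _ : X.Total => ℂ) 2 :=
  relOp (X.rel e) (X.rel_biUnique e)

theorem op_of_rel {e : Arrow Λ} {a b : X.Total} (h : X.rel e a b)
    (ξ : lp (fun _ : X.Total => ℂ) 2) : X.op e ξ b = ξ a := relOp_of_rel _ ξ h

theorem op_of_not {e : Arrow Λ} {b : X.Total} (h : ∀ a, ¬ X.rel e a b)
    (ξ : lp (fun _ : X.Total => ℂ) 2) : X.op e ξ b = 0 := relOp_of_not _ ξ h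

theorem star_op_of_rel {e : Arrow Λ} {a b : X.Total} (h : X.rel e a b)
    (ξ : lp (fun _ : X.Total => ℂ) 2) : star (X.op e) ξ a = ξ b := by
  rw [op, star_relOp]
  exact relOp_of_rel (biUnique_flip (X.rel_biUnique e)) ξ h

theorem star_op_of_not {e : Arrow Λ} {a : X.Total} (h : ∀ b, ¬ X.rel e a b)
    (ξ : lp (fun _ : X.Total => ℂ) 2) : star (X.op e) ξ a = 0 := by
  rw [op, star_relOp]
  exact relOp_of_not (biUnique_flip (X.rel_biUnique e)) ξ h

theorem op_vertex_self {v : Λ} (a : X.carrier v) (ξ : lp (fun _ : X.Total => ℂ) 2) :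
    X.op (Arrow.mk (𝟙 v)) ξ ⟨v, a⟩ = ξ ⟨v, a⟩ :=
  X.op_of_rel (e := Arrow.mk (𝟙 v)) (X.rel_vertex.2 ⟨rfl, rfl⟩) ξ

theorem op_vertex_ne {v : Λ} {a : X.Total} (h : a.1 ≠ v) (ξ : lp (fun _ : X.Total => ℂ) 2) :
    X.op (Arrow.mk (𝟙 v)) ξ a = 0 :=
  X.op_of_not (fun b hb => by
    obtain ⟨rfl, hv⟩ := X.rel_vertex.1 hb
    exact h hv) ξ

theorem star_op_mul_op (e : Arrow Λ) : star (X.op e) * X.op e = X.op (Arrow.mk (𝟙 e.left)) := by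
  ext ξ a
  rw [mul_apply_eq_comp]
  by_cases h : a.1 = e.left
  · obtain ⟨x, a⟩ := a
    dsimp only at h
    subst h
    have hr : X.rel e ⟨_, a⟩ ⟨_, X.act e.hom a⟩ := ⟨a, rfl, rfl⟩
    rw [X.star_op_of_rel hr, X.op_of_rel hr, X.op_vertex_self]
  · rw [X.op_vertex_ne h, X.star_op_of_not]
    rintro b ⟨c, rfl, -⟩
    exact h rfl

theorem op_mul_op {x y z : Λ} (f : x ⟶ y) (e : y ⟶ z) (he : IsGen (Arrow.mk e))
    (hf : IsGen (Arrow.mk f)) (h : d e < d f) :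
    X.op (Arrow.mk e) * X.op (Arrow.mk f) = X.op (Arrow.mk (f ≫ e)) := by
  ext ξ b
  rw [mul_apply_eq_comp]
  by_cases hb : ∃ a, X.rel (Arrow.mk (f ≫ e)) a b
  · obtain ⟨a, ha⟩ := hb
    rw [X.op_of_rel ha]
    obtain ⟨c, rfl, rfl⟩ := ha
    have h1 : X.rel (Arrow.mk f) ⟨x, c⟩ ⟨y, X.act f c⟩ := ⟨c, rfl, rfl⟩
    have h2 : X.rel (Arrow.mk e) ⟨y, X.act f c⟩ ⟨z, X.act (f ≫ e) c⟩ :=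
      ⟨X.act f c, rfl, congrArg (Sigma.mk z) (X.act_comp f e he hf h c)⟩
    exact (X.op_of_rel h2 _).trans (X.op_of_rel h1 _)
  · rw [X.op_of_not (not_exists.1 hb)]
    by_cases he' : ∃ a, X.rel (Arrow.mk e) a b
    · obtain ⟨a, ha⟩ := he'
      rw [X.op_of_rel ha]
      refine X.op_of_not (fun a' ha' => hb ⟨a', ?_⟩) ξ
      obtain ⟨c, rfl, rfl⟩ := ha
      obtain ⟨c', rfl, h'⟩ := ha'
      have : c = X.act f c' := eq_of_heq (Sigma.ext_iff.1 h').2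
      subst this
      exact ⟨c', rfl, congrArg (Sigma.mk z) (X.act_comp f e he hf h c').symm⟩
    · exact X.op_of_not (not_exists.1 he') _

theorem star_op_mul_op_of_disjoint (e f : Arrow Λ) (h : extensions e ∩ extensions f = ∅) :
    star (X.op e) * X.op f = 0 := by
  ext ξ a
  rw [mul_apply_eq_comp]
  by_cases ha : ∃ b, X.rel e a b
  · obtain ⟨b, hb⟩ := ha
    rw [X.star_op_of_rel hb]
    refine X.op_of_not (fun a' hb' => ?_) ξ
    obtain ⟨x, z, e⟩ := e
    obtain ⟨y, z', f⟩ := f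
    obtain ⟨c, rfl, rfl⟩ := hb
    obtain ⟨c', rfl, h'⟩ := hb'
    obtain rfl : z = z' := congrArg Sigma.fst h'
    exact (X.comparable e f c c' (eq_of_heq (Sigma.ext_iff.1 h').2)).ne_empty h
  · exact X.star_op_of_not (not_exists.1 ha) _

theorem op_mul_star_op_of_rel {e : Arrow Λ} {a b : X.Total} (h : X.rel e a b)
    (ξ : lp (fun _ : X.Total => ℂ) 2) : (X.op e * star (X.op e)) ξ b = ξ b := by
  rw [mul_apply_eq_comp, X.op_of_rel h, X.star_op_of_rel h]

theorem op_mul_star_op_of_not {e : Arrow Λ} {b : X.Total} (h : ∀ a, ¬ X.rel e a b)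
    (ξ : lp (fun _ : X.Total => ℂ) 2) : (X.op e * star (X.op e)) ξ b = 0 := by
  rw [mul_apply_eq_comp, X.op_of_not h]

/-- Two paths of equal length with a common extension coincide by unique factorization. Hence the
ranges of different `p` in relation (4) are disjoint. -/
theorem eq_of_act_eq {v : Λ} {β : Ordinal.{u}} (p q : PathsTo v β) (a : X.carrier p.1)
    (b : X.carrier q.1) (h : X.act p.2.1 a = X.act q.2.1 b) : p = q := by
  obtain ⟨x, p, hp⟩ := p
  obtain ⟨y, q, hq⟩ := q
  obtain ⟨_, ⟨z, g, rfl⟩, ⟨z', g', hg⟩⟩ := X.comparable p q a b h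
  obtain rfl : z = z' := congrArg Comma.left hg
  have hg' : g ≫ p = g' ≫ q := (Arrow.mk_inj _ _).1 hg
  have hle : β ≤ d (g ≫ p) := by rw [d_comp]; exact hp ▸ le_self_add
  have := (factor (g ≫ p) β hle).unique (y₁ := ⟨x, p, g⟩) (y₂ := ⟨y, q, g'⟩)
    ⟨hp, rfl⟩ ⟨hq, hg'.symm⟩
  cases this
  rfl

/-- At a point over `v` exactly one summand survives: `covering` provides it and `eq_of_act_eq`
excludes any other. -/
theorem op_vertex_eq_sum {v : Λ} {β : Ordinal.{u}} (hv : IsRegular v β) :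
    X.op (Arrow.mk (𝟙 v)) =
      ∑ᶠ p : PathsTo v (ω ^ β), X.op (Arrow.mk p.2.1) * star (X.op (Arrow.mk p.2.1)) := by
  have : Finite (PathsTo v (ω ^ β)) := hv.2
  have := Fintype.ofFinite (PathsTo v (ω ^ β))
  rw [finsum_eq_sum_of_fintype]
  ext ξ b
  rw [sum_apply, lp.coeFn_sum, Finset.sum_apply]
  by_cases hb : b.1 = v
  · obtain ⟨v, b⟩ := b
    dsimp only at hb
    subst hb
    obtain ⟨p, a, hp⟩ := X.covering hv b
    rw [X.op_vertex_self, Finset.sum_eq_single p]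
    · exact (X.op_mul_star_op_of_rel (e := Arrow.mk p.2.1) ⟨a, rfl, by rw [← hp]; rfl⟩ ξ).symm
    · intro q _ hq
      refine X.op_mul_star_op_of_not (fun a' ha' => hq ?_) ξ
      obtain ⟨c, rfl, hc⟩ := ha'
      refine X.eq_of_act_eq q p c a ?_
      rw [hp]
      exact (eq_of_heq (Sigma.ext_iff.1 hc).2).symm
    · exact fun h => absurd (Finset.mem_univ _) h
  · rw [X.op_vertex_ne hb, Finset.sum_eq_zero]
    intro p _
    refine X.op_mul_star_op_of_not ?_ ξ
    rintro a ⟨c, rfl, rfl⟩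
    exact hb rfl

/-- The Cuntz-Krieger family on the `ℓ²`-space of the disjoint union. -/
noncomputable def family :
    CKFamily Λ (lp (fun _ : X.Total => ℂ) 2 →L[ℂ] lp (fun _ : X.Total => ℂ) 2) where
  T e := X.op e.1
  star_mul_self e := X.star_op_mul_op e.1
  mul_of_lt f e he hf h := X.op_mul_op f e he hf h
  star_mul_of_disjoint e f h := X.star_op_mul_op_of_disjoint e.1 f.1 h
  sum_regular _ _ h := X.op_vertex_eq_sum h

/-- The family `family` together with its C*-algebra. -/
noncomputable def rep : CKRep Λ where
  carrier := lp (fun _ : X.Total => ℂ) 2 →L[ℂ] lp (fun _ : X.Total => ℂ) 2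
  family := X.family

theorem op_basisVec {x y : Λ} (e : x ⟶ y) (a : X.carrier x) :
    X.op (Arrow.mk e) (basisVec ⟨x, a⟩) = basisVec ⟨y, X.act e a⟩ :=
  relOp_basisVec _ ⟨a, rfl, rfl⟩

end BoundarySystem

end Action

/-! ### Boundary paths as maximal chains, graded by an integer -/

section MaxChain

variable {Λ : Type u} [SmallCategory Λ]

/-- A path with range `v` and arbitrary source. -/
abbrev PathInto (v : Λ) : Type u := Σ x : Λ, (x ⟶ v)

/-- `p` is an initial segment of `q`. -/
def IsPrefix {v : Λ} (p q : PathInto v) : Prop := ∃ h : q.1 ⟶ p.1, h ≫ p.2 = q.2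

/-- The path `ep`. -/
def PathInto.comp {x v : Λ} (p : PathInto x) (e : x ⟶ v) : PathInto v := ⟨p.1, p.2 ≫ e⟩

theorem IsPrefix.refl {v : Λ} (p : PathInto v) : IsPrefix p p := ⟨𝟙 _, Category.id_comp _⟩

theorem IsPrefix.trans {v : Λ} {p q r : PathInto v} (h : IsPrefix p q) (h' : IsPrefix q r) :
    IsPrefix p r := by
  obtain ⟨a, ha⟩ := h
  obtain ⟨b, hb⟩ := h'
  exact ⟨b ≫ a, by rw [Category.assoc, ha, hb]⟩

instance {v : Λ} : Std.Refl (IsPrefix (v := v)) := ⟨IsPrefix.refl⟩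

instance {v : Λ} : IsTrans (PathInto v) IsPrefix := ⟨fun _ _ _ => IsPrefix.trans⟩

theorem isPrefix_id {v : Λ} (p : PathInto v) : IsPrefix ⟨v, 𝟙 v⟩ p :=
  ⟨p.2, Category.comp_id _⟩

theorem isPrefix_comp {x v : Λ} (e : x ⟶ v) (p : PathInto x) : IsPrefix ⟨x, e⟩ (p.comp e) :=
  ⟨p.2, rfl⟩

theorem IsPrefix.exists_comp {x v : Λ} {e : x ⟶ v} {p : PathInto v} (h : IsPrefix ⟨x, e⟩ p) :
    ∃ q : PathInto x, q.comp e = p := by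
  obtain ⟨y, p⟩ := p
  obtain ⟨q, hq⟩ := h
  exact ⟨⟨y, q⟩, congrArg (Sigma.mk y) hq⟩

theorem _root_.IsMaxChain.mem_of_forall {ι : Type*} {r : ι → ι → Prop} {F : Set ι}
    (hF : IsMaxChain r F) {p : ι} (h : ∀ q ∈ F, r p q ∨ r q p) : p ∈ F := by
  rw [hF.2 (hF.1.insert fun q hq _ => h q hq) (Set.subset_insert _ _)]
  exact Set.mem_insert _ _

theorem id_mem {v : Λ} {F : Set (PathInto v)} (hF : IsMaxChain IsPrefix F) : ⟨v, 𝟙 v⟩ ∈ F :=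
  hF.mem_of_forall fun q _ => Or.inl (isPrefix_id q)

/-- The initial segments of the paths `ep` with `p` in `F`. -/
def pushChain {x v : Λ} (e : x ⟶ v) (F : Set (PathInto x)) : Set (PathInto v) :=
  {q | ∃ p ∈ F, IsPrefix q (p.comp e)}

theorem mem_pushChain_of_isPrefix {x v : Λ} {e : x ⟶ v} {F : Set (PathInto x)}
    (hF : IsMaxChain IsPrefix F) {q : PathInto v} (h : IsPrefix q ⟨x, e⟩) :
    q ∈ pushChain e F :=
  ⟨_, id_mem hF, h.trans (isPrefix_comp e _)⟩

variable [OrdinalGraph Λ]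

theorem isPrefix_comp_iff {x v : Λ} (e : x ⟶ v) {p q : PathInto x} :
    IsPrefix (p.comp e) (q.comp e) ↔ IsPrefix p q := by
  refine exists_congr fun h => ?_
  rw [← (comp_right_injective e).eq_iff]
  exact Eq.congr_left (Category.assoc h p.2 e).symm

theorem IsPrefix.total_of_isPrefix {v : Λ} {p q r : PathInto v} (h : IsPrefix p r)
    (h' : IsPrefix q r) : IsPrefix p q ∨ IsPrefix q p := by
  obtain ⟨a, ha⟩ := h
  obtain ⟨b, hb⟩ := h'
  rcases le_total (d p.2) (d q.2) with hd | hd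
  · exact Or.inl (comparable p.2 q.2 a b (ha.trans hb.symm) hd)
  · exact Or.inr (comparable q.2 p.2 b a (hb.trans ha.symm) hd)

variable {v x : Λ} {F : Set (PathInto v)}

theorem mem_of_isPrefix (hF : IsMaxChain IsPrefix F) {p q : PathInto v} (hq : q ∈ F)
    (h : IsPrefix p q) : p ∈ F := by
  refine hF.mem_of_forall fun r hr => ?_
  rcases hF.1.total hq hr with h' | h'
  · exact Or.inl (h.trans h')
  · exact h.total_of_isPrefix h'

theorem comp_mem_pushChain {e : x ⟶ v} {F : Set (PathInto x)} (hF : IsMaxChain IsPrefix F)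
    {p : PathInto x} : p.comp e ∈ pushChain e F ↔ p ∈ F := by
  constructor
  · rintro ⟨q, hq, h⟩
    exact mem_of_isPrefix hF hq ((isPrefix_comp_iff e).1 h)
  · exact fun h => ⟨p, h, IsPrefix.refl _⟩

/-- A member of a larger chain is comparable with `e`. Either it is a prefix of `e`, or it has the
form `ep`; cancelling `e` makes `p` comparable with all of `F`, so maximality of `F` applies. -/
theorem isMaxChain_pushChain (e : x ⟶ v) {F : Set (PathInto x)} (hF : IsMaxChain IsPrefix F) :
    IsMaxChain IsPrefix (pushChain e F) := by
  constructor
  · rintro q ⟨p, hp, h⟩ q' ⟨p', hp', h'⟩ -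
    rcases hF.1.total hp hp' with hpp | hpp
    · exact (h.trans ((isPrefix_comp_iff e).2 hpp)).total_of_isPrefix h'
    · exact h.total_of_isPrefix (h'.trans ((isPrefix_comp_iff e).2 hpp))
  · intro t ht hsub
    refine hsub.antisymm fun q hq => ?_
    rcases ht.total hq (hsub (mem_pushChain_of_isPrefix hF (IsPrefix.refl ⟨x, e⟩))) with h | h
    · exact mem_pushChain_of_isPrefix hF h
    · obtain ⟨p, rfl⟩ := h.exists_comp
      rw [comp_mem_pushChain hF]
      refine hF.mem_of_forall fun p' hp' => ?_
      rw [← isPrefix_comp_iff e, ← isPrefix_comp_iff e]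
      exact ht.total hq (hsub ((comp_mem_pushChain hF).2 hp'))

/-- The witness is the set of all `q` with `eq` in `F`, that is, `F` with its initial segment `e`
removed. -/
theorem exists_pushChain_eq (hF : IsMaxChain IsPrefix F) {e : x ⟶ v} (he : ⟨x, e⟩ ∈ F) :
    ∃ G : Set (PathInto x), IsMaxChain IsPrefix G ∧ pushChain e G = F := by
  have hG : IsMaxChain IsPrefix {q : PathInto x | q.comp e ∈ F} := by
    constructor
    · intro p hp q hq _
      have := hF.1.total hp hq
      rwa [isPrefix_comp_iff, isPrefix_comp_iff] at this
    · intro t ht hsub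
      refine hsub.antisymm fun q hq => hF.mem_of_forall fun r hr => ?_
      rcases hF.1.total hr he with h | h
      · exact Or.inr (h.trans (isPrefix_comp e q))
      · obtain ⟨p, rfl⟩ := h.exists_comp
        rw [isPrefix_comp_iff, isPrefix_comp_iff]
        exact ht.total hq (hsub hr)
  refine ⟨_, hG, ?_⟩
  ext q
  constructor
  · rintro ⟨p, hp, h⟩
    exact mem_of_isPrefix hF hp h
  · intro hq
    rcases hF.1.total hq he with h | h
    · exact mem_pushChain_of_isPrefix hG h
    · obtain ⟨p, rfl⟩ := h.exists_comp
      exact (comp_mem_pushChain hG).2 hq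

/-- A long member of `F` can be cut at `ω ^ β`. Otherwise source-regularity extends each member to a
path of length `ω ^ β`. There are finitely many such paths, so one of them extends all of `F`: if
each failed at some member, an upper bound of these members would have no extension. By maximality
that path belongs to `F`. -/
theorem exists_mem_of_isRegular (hF : IsMaxChain IsPrefix F) {β : Ordinal.{u}}
    (hv : IsRegular v β) : ∃ p ∈ F, d p.2 = ω ^ β := by
  by_cases hlong : ∃ p ∈ F, ω ^ β ≤ d p.2
  · obtain ⟨p, hp, h⟩ := hlong
    obtain ⟨⟨z, q, q'⟩, ⟨h1, h2⟩, -⟩ := factor p.2 _ h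
    exact ⟨⟨z, q⟩, mem_of_isPrefix hF hp ⟨q', h2⟩, h1⟩
  · have : Finite (PathsTo v (ω ^ β)) := hv.2
    have hex : ∀ q ∈ F, ∃ P : PathsTo v (ω ^ β), IsPrefix q ⟨P.1, P.2.1⟩ := fun q hq => by
      have hlt : d q.2 < ω ^ β := lt_of_not_ge fun h => hlong ⟨q, hq, h⟩
      obtain ⟨y, h, hh⟩ := hv.1 q.1 q.2 hlt
      exact ⟨⟨y, h ≫ q.2, d_comp_of_lt_opow hh hlt⟩, h, rfl⟩
    have hbd : ∃ P : PathsTo v (ω ^ β), ∀ q ∈ F, IsPrefix q ⟨P.1, P.2.1⟩ := by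
      by_contra! hcon
      choose q hq hqP using hcon
      have hdir : Directed IsPrefix ((↑) : F → PathInto v) := fun a b => by
        rcases hF.1.total a.2 b.2 with h | h
        · exact ⟨b, h, IsPrefix.refl _⟩
        · exact ⟨a, IsPrefix.refl _, h⟩
      have : Nonempty F := ⟨⟨_, id_mem hF⟩⟩
      obtain ⟨z, hz⟩ := hdir.finite_le fun P => (⟨q P, hq P⟩ : F)
      obtain ⟨P, hP⟩ := hex z z.2
      exact hqP P ((hz P).trans hP)
    obtain ⟨P, hP⟩ := hbd
    exact ⟨⟨P.1, P.2.1⟩, hF.mem_of_forall fun q hq => Or.inr (hP q hq), P.2.2⟩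

variable (Λ) in
/-- The boundary paths (maximal chains of paths with respect to the prefix order), together with
an integer that counts the pieces of length `ω ^ α`. -/
noncomputable def gradedBoundary (α : Ordinal.{u})
    (hΛ : ∀ {x y : Λ} (e : x ⟶ y), d e < ω ^ (α + 1)) : BoundarySystem Λ :=
  open Classical in
  { carrier := fun v => {F : Set (PathInto v) // IsMaxChain IsPrefix F} × ℤ
    act := fun e a => (⟨pushChain e a.1.1, isMaxChain_pushChain e a.1.2⟩,
      a.2 + if d e = ω ^ α then 1 else 0)
    act_injective := by
      rintro x y e ⟨⟨F, hF⟩, m⟩ ⟨⟨G, hG⟩, n⟩ h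
      simp only [Prod.mk.injEq, Subtype.mk.injEq, add_left_inj] at h ⊢
      refine ⟨Set.ext fun p => ?_, h.2⟩
      rw [← comp_mem_pushChain (e := e) hF, h.1, comp_mem_pushChain hG]
    act_id := by
      rintro x ⟨⟨F, hF⟩, m⟩
      have h0 : d (𝟙 x) ≠ ω ^ α := by
        rw [d_id]
        exact (Ordinal.opow_pos _ Ordinal.omega0_pos).ne
      simp only [if_neg h0, add_zero, Prod.mk.injEq, Subtype.mk.injEq, and_true]
      ext p
      rw [← comp_mem_pushChain (e := 𝟙 x) hF]
      simp [PathInto.comp]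
    act_comp := by
      rintro x y z f e he hf hd ⟨⟨F, hF⟩, m⟩
      -- A generator longer than `ω ^ α` would have length at least `ω ^ (α + 1)`, against `hΛ`. So
      -- the absorbed path `e` is not counted.
      have he' : d e ≠ ω ^ α := by
        intro he'
        rcases hf with hf | ⟨β, hf⟩
        · rw [show d f = 0 from hf] at hd
          exact not_lt_zero hd
        · replace hf : d f = ω ^ β := hf
          have h1 := hΛ f
          rw [hf, Ordinal.opow_lt_opow_iff_right Ordinal.one_lt_omega0] at h1
          rw [hf, he', Ordinal.opow_lt_opow_iff_right Ordinal.one_lt_omega0] at hd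
          exact not_lt.2 (Order.lt_add_one_iff.1 h1) hd
      simp only [d_comp_of_lt f e hf hd, if_neg he', add_zero, Prod.mk.injEq, Subtype.mk.injEq,
        and_true]
      ext q
      constructor
      · rintro ⟨p, hp, h⟩
        refine ⟨p.comp f, ⟨p, hp, IsPrefix.refl _⟩, ?_⟩
        simpa [PathInto.comp] using h
      · rintro ⟨r, ⟨p, hp, h⟩, h'⟩
        refine ⟨p, hp, ?_⟩
        simpa [PathInto.comp] using h'.trans ((isPrefix_comp_iff e).2 h)
    comparable := by
      rintro x y z e f ⟨⟨F, hF⟩, m⟩ ⟨⟨G, hG⟩, n⟩ h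
      simp only [Prod.mk.injEq, Subtype.mk.injEq] at h
      have h1 := mem_pushChain_of_isPrefix hF (IsPrefix.refl ⟨x, e⟩)
      have h2 := mem_pushChain_of_isPrefix hG (IsPrefix.refl ⟨y, f⟩)
      rw [← h.1] at h2
      rcases (isMaxChain_pushChain e hF).1.total h1 h2 with ⟨g, hg⟩ | ⟨g, hg⟩
      · exact ⟨Arrow.mk f, ⟨y, g, congrArg Arrow.mk hg.symm⟩,
          ⟨y, 𝟙 y, congrArg Arrow.mk (Category.id_comp f).symm⟩⟩
      · exact ⟨Arrow.mk e, ⟨x, 𝟙 x, congrArg Arrow.mk (Category.id_comp e).symm⟩,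
          ⟨x, g, congrArg Arrow.mk hg.symm⟩⟩
    covering := by
      rintro v β hv ⟨⟨F, hF⟩, m⟩
      obtain ⟨p, hp, hd⟩ := exists_mem_of_isRegular hF hv
      obtain ⟨G, hG, h⟩ := exists_pushChain_eq hF hp
      -- The counter must be able to decrease without bound, which is why it lies in `ℤ` and not in
      -- `ℕ`.
      refine ⟨⟨p.1, p.2, hd⟩, ⟨⟨G, hG⟩, m - if d p.2 = ω ^ α then 1 else 0⟩, ?_⟩
      simp only [h, sub_add_cancel] }

/-- Here `k` counts the Cantor pieces of length `ω ^ α`, and it is the same for all basis vectors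
over the source. -/
theorem pathElem_gradedBoundary {α : Ordinal.{u}}
    (hΛ : ∀ {x y : Λ} (e : x ⟶ y), d e < ω ^ (α + 1)) (e : Arrow Λ) :
    ∃ k : ℕ, (ω ^ α ≤ d e.hom → 0 < k) ∧
      ∀ a : (gradedBoundary Λ α hΛ).carrier e.left,
        ∃ b : (gradedBoundary Λ α hΛ).carrier e.right, b.2 = a.2 + k ∧
          pathElem (gradedBoundary Λ α hΛ).family.T e (basisVec ⟨e.left, a⟩) =
            basisVec ⟨e.right, b⟩ := by
  have hgen : ∀ e : Arrow Λ, IsGen e → ∃ k : ℕ, (ω ^ α ≤ d e.hom → 0 < k) ∧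
      ∀ a : (gradedBoundary Λ α hΛ).carrier e.left,
        ∃ b : (gradedBoundary Λ α hΛ).carrier e.right, b.2 = a.2 + k ∧
          (gradedBoundary Λ α hΛ).op e (basisVec ⟨e.left, a⟩) = basisVec ⟨e.right, b⟩ := by
    intro e he
    refine ⟨if d e.hom = ω ^ α then 1 else 0, fun h => ?_, fun a =>
      ⟨(gradedBoundary Λ α hΛ).act e.hom a, ?_, (gradedBoundary Λ α hΛ).op_basisVec e.hom a⟩⟩
    · rw [if_pos]
      · exact one_pos
      · rcases he with he | ⟨β, he⟩
        · rw [he] at h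
          exact absurd h (not_le.2 (Ordinal.opow_pos _ Ordinal.omega0_pos))
        · have h1 := hΛ e.hom
          rw [he, Ordinal.opow_lt_opow_iff_right Ordinal.one_lt_omega0] at h1
          rw [he, Ordinal.opow_le_opow_iff_right Ordinal.one_lt_omega0] at h
          rw [he, (Order.lt_add_one_iff.1 h1).antisymm h]
    · simp only [gradedBoundary]
      push_cast
      rfl
  induction e using path_induction with
  | gen e h =>
    obtain ⟨k, hk, hk'⟩ := hgen e h
    refine ⟨k, hk, fun a => ?_⟩
    rw [pathElem_of_isGen _ _ h]
    exact hk' a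
  | cons e h ih =>
    obtain ⟨k, -, hk'⟩ := ih
    obtain ⟨l, hl, hl'⟩ := hgen (headGen e h).1 (headGen e h).2
    -- Positivity comes from the head alone: its length is the leading power of `ω` in `d e`, which
    -- is at least `ω ^ α` once `d e` is.
    refine ⟨k + l, fun hle => Nat.add_pos_right k (hl ?_), fun a => ?_⟩
    · have h0 : d e.hom ≠ 0 := fun h0 => h (Or.inl h0)
      have hd : d (headGen e h).1.hom = ω ^ Ordinal.log ω (d e.hom) :=
        (split_spec e.hom _ (log_le h)).1
      rw [hd]
      exact Ordinal.opow_le_opow_right Ordinal.omega0_pos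
        ((Ordinal.opow_le_iff_le_log Ordinal.one_lt_omega0 h0).1 hle)
    · obtain ⟨b, hb, hb'⟩ := hk' a
      obtain ⟨c, hc, hc'⟩ := hl' b
      refine ⟨c, ?_, ?_⟩
      · rw [Nat.cast_add, ← add_assoc, ← hb]
        exact hc
      · rw [pathElem_of_not_isGen _ _ h, mul_apply_eq_comp]
        exact (congrArg _ hb').trans hc'

theorem powSucc_pathElem_ne_vertex {α : Ordinal.{u}}
    (hΛ : ∀ {x y : Λ} (e : x ⟶ y), d e < ω ^ (α + 1)) {v : Λ} (g : v ⟶ v)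
    (hg : ω ^ α ≤ d g) (n : ℕ) :
    powSucc (pathElem (gradedBoundary Λ α hΛ).family.T (Arrow.mk g)) n ≠
      (gradedBoundary Λ α hΛ).family.T (Gen.vertex v) := by
  obtain ⟨k, hk, hk'⟩ := pathElem_gradedBoundary hΛ (Arrow.mk g)
  have hpow : ∀ (n : ℕ) (a : (gradedBoundary Λ α hΛ).carrier v),
      ∃ b : (gradedBoundary Λ α hΛ).carrier v, b.2 = a.2 + (n + 1) * k ∧
        powSucc (pathElem (gradedBoundary Λ α hΛ).family.T (Arrow.mk g)) n (basisVec ⟨v, a⟩) =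
          basisVec ⟨v, b⟩ := by
    intro n
    induction n with
    | zero =>
      intro a
      obtain ⟨b, hb, hb'⟩ := hk' a
      exact ⟨b, by rw [hb]; push_cast; ring, hb'⟩
    | succ n ih =>
      intro a
      obtain ⟨b, hb, hb'⟩ := hk' a
      obtain ⟨c, hc, hc'⟩ := ih b
      refine ⟨c, by rw [hc, hb]; push_cast; ring, ?_⟩
      rw [powSucc, mul_apply_eq_comp]
      exact (congrArg _ hb').trans hc'
  -- Extending the empty chain shows that there is a basis vector over `v` to test on.
  obtain ⟨F, hF, -⟩ := (IsChain.empty (r := IsPrefix (v := v))).exists_maxChain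
  let a : (gradedBoundary Λ α hΛ).carrier v := (⟨F, hF⟩, 0)
  obtain ⟨b, hb, hb'⟩ := hpow n a
  intro heq
  rw [heq] at hb'
  have hid : (gradedBoundary Λ α hΛ).family.T (Gen.vertex v) (basisVec ⟨v, a⟩) =
      basisVec ⟨v, a⟩ := by
    refine ((gradedBoundary Λ α hΛ).op_basisVec (𝟙 v) a).trans ?_
    rw [(gradedBoundary Λ α hΛ).act_id]
  have hab := basisVec_injective (hid.symm.trans hb')
  obtain rfl : a = b := eq_of_heq (Sigma.ext_iff.1 hab).2
  have hk0 : (0 : ℤ) < (n + 1) * k := by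
    have := hk hg
    positivity
  linarith

end MaxChain

/-! ### Transfer to the universal algebras and conclusion -/

theorem powSucc_pathT_ne_gen {Λ : Type u} [SmallCategory Λ] [OrdinalGraph Λ] {α : Ordinal.{u}}
    (hΛ : ∀ {x y : Λ} (e : x ⟶ y), d e < ω ^ (α + 1)) {v : Λ} (g : v ⟶ v)
    (hg : ω ^ α ≤ d g) (n : ℕ) : powSucc (pathT g) n ≠ gen (Gen.vertex v) := by
  intro h
  refine powSucc_pathElem_ne_vertex hΛ g hg n ?_
  have := congrArg (evalAt (gradedBoundary Λ α hΛ).rep) h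
  rw [map_powSucc, pathT, map_pathElem] at this
  exact this

theorem exists_rho_powSucc_eq {Λ : Type u} [SmallCategory Λ] [OrdinalGraph Λ] {γ : Ordinal.{u}}
    {v : Λ} (hv : IsRegular v γ) (g : v ⟶ v) (hg : d g < ω ^ γ) :
    ∃ n : ℕ, rho γ (powSucc (pathT (Λ := Trunc Λ γ) (x := ⟨v⟩) (y := ⟨v⟩) ⟨g, hg⟩) n) =
      rho γ (gen (Gen.vertex (⟨v⟩ : Trunc Λ γ))) := by
  obtain ⟨n, hn⟩ := CKFamily.exists_powSucc_eq_vertex (A := O Λ) hv g hg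
  refine ⟨n, ?_⟩
  rw [map_powSucc, pathT, map_pathElem]
  -- Composing the generators of the truncated algebra with `rho` gives, by definition, the
  -- restriction of `genFamily`.
  exact hn genFamily

theorem d_lt_opow {Λ : Type u} [SmallCategory Λ] [OrdinalGraph Λ] {γ : Ordinal.{u}}
    {x y : Trunc Λ γ} (e : x ⟶ y) : d e < ω ^ γ :=
  InducedWideCategory.Hom.property e

end OrdGraph

theorem mainTheorem6 (Λ : Type u) [CategoryTheory.SmallCategory Λ] [OrdGraph.OrdinalGraph Λ]
    (α : Ordinal.{u}) :
    (Function.Injective (OrdGraph.rho (Λ := Λ) (α + 1)) →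
      ¬ ∃ (w v : Λ) (f : w ⟶ v) (g : v ⟶ v),
        OrdGraph.OrdinalGraph.d f = ω ^ (α + 1) ∧ OrdGraph.IsRegular v (α + 1) ∧
        OrdGraph.OrdinalGraph.d g < ω ^ (α + 1) ∧ ¬ OrdGraph.OrdinalGraph.d g < ω ^ α ∧
        f ≫ g = f) ∧
    (∀ (w v : Λ) (f : w ⟶ v) (g : v ⟶ v) (hg : OrdGraph.OrdinalGraph.d g < ω ^ (α + 1)),
      OrdGraph.OrdinalGraph.d f = ω ^ (α + 1) → OrdGraph.IsRegular v (α + 1) →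
      ¬ OrdGraph.OrdinalGraph.d g < ω ^ α → f ≫ g = f →
      ∃ n : ℕ,
        OrdGraph.powSucc (OrdGraph.pathT (Λ := OrdGraph.Trunc Λ (α + 1))
            (x := ⟨v⟩) (y := ⟨v⟩) ⟨g, hg⟩) n
          - OrdGraph.gen (OrdGraph.Gen.vertex (⟨v⟩ : OrdGraph.Trunc Λ (α + 1))) ≠ 0 ∧
        OrdGraph.rho (α + 1)
          (OrdGraph.powSucc (OrdGraph.pathT (Λ := OrdGraph.Trunc Λ (α + 1))
              (x := ⟨v⟩) (y := ⟨v⟩) ⟨g, hg⟩) n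
            - OrdGraph.gen (OrdGraph.Gen.vertex (⟨v⟩ : OrdGraph.Trunc Λ (α + 1)))) = 0) := by
  have key : ∀ (w v : Λ) (f : w ⟶ v) (g : v ⟶ v)
      (hg : OrdGraph.OrdinalGraph.d g < ω ^ (α + 1)),
      OrdGraph.OrdinalGraph.d f = ω ^ (α + 1) → OrdGraph.IsRegular v (α + 1) →
      ¬ OrdGraph.OrdinalGraph.d g < ω ^ α → f ≫ g = f →
      ∃ n : ℕ,
        OrdGraph.powSucc (OrdGraph.pathT (Λ := OrdGraph.Trunc Λ (α + 1))
            (x := ⟨v⟩) (y := ⟨v⟩) ⟨g, hg⟩) n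
          - OrdGraph.gen (OrdGraph.Gen.vertex (⟨v⟩ : OrdGraph.Trunc Λ (α + 1))) ≠ 0 ∧
        OrdGraph.rho (α + 1)
          (OrdGraph.powSucc (OrdGraph.pathT (Λ := OrdGraph.Trunc Λ (α + 1))
              (x := ⟨v⟩) (y := ⟨v⟩) ⟨g, hg⟩) n
            - OrdGraph.gen (OrdGraph.Gen.vertex (⟨v⟩ : OrdGraph.Trunc Λ (α + 1)))) = 0 := by
    intro w v f g hg _ hv hg' _
    obtain ⟨n, hn⟩ := OrdGraph.exists_rho_powSucc_eq hv g hg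
    refine ⟨n, sub_ne_zero.2 ?_, by rw [map_sub, hn, sub_self]⟩
    exact OrdGraph.powSucc_pathT_ne_gen (Λ := OrdGraph.Trunc Λ (α + 1)) OrdGraph.d_lt_opow
      _ (not_lt.1 hg') n
  refine ⟨?_, key⟩
  rintro hinj ⟨w, v, f, g, hf, hv, hg, hg', hfg⟩
  obtain ⟨n, hn, h0⟩ := key w v f g hg hf hv hg' hfg
  exact hn (hinj (h0.trans (map_zero _).symm))
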